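/- Let $n\ge 4$, let $J\subseteq\mathbb R$ be a non-empty open interval, let $(M^*,g^*)$ be a smooth Riemannian manifold of dimension $n-1$, and let $a:J\to(0,\infty)$ be smooth. Consider the generalized Robertson–Walker spacetime $M=J\times M^*$ with the Lorentzian metric $g=-dt^2+a(t)^2g^*$, and let $S$ denote its Ricci tensor and $\nabla$ its Levi-Civita connection. A vector field $\rho$ is called torse-forming if $\nabla_U\rho=\omega(U)\rho+\psi U$ for all $U$, for some smooth function $\psi$ and some 1-form $\omega$. (a) The field $\partial_t$ is a smooth unit timelike torse-forming vector field and an eigenvector of the Ricci tensor, i.e. with $\eta=g(\cdot,\partial_t)$ one has $S(U,\partial_t)=\xi\,\eta(U)$ for all $U$ and some function $\xi$ on $M$. (b) Let $\rho$ be any smooth unit timelike ($g(\rho,\rho)=-1$) torse-forming vector field on $M$ that is an eigenvector of the Ricci tensor, $S(U,\rho)=\xi\,\eta(U)$ with $\eta=g(\cdot,\rho)$ (for instance $\rho=\partial_t$), and assume that the eigenvalue $\xi$ is non-zero (it suffices that $\xi$ is not identically zero). Suppose that $M$ carries a gradient Ricci soliton $$\operatorname{Hess} f+S+\lambda_1 g=0$$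 with a smooth function $f:M\to\mathbb R$ and a real constant $\lambda_1$, and that $\rho f$ is constant. Then $M$ is a perfect-fluid spacetime with velocity field $\rho$: the Ricci tensor $S$ vanishes at no point, and there are smooth functions $a_1,b_1$ on $M$ with $$S=a_1\,g+b_1\,\eta\otimes\eta .$$ -/

import Mathlib

set_option maxSynthPendingDepth 3

open scoped Manifold ContDiff
open TopologicalSpace Bundle

noncomputable section

namespace GRW

/-! ### Semi-Riemannian calculus on an open subset of a vector space

`G x` is the metric at the point `x`, a bilinear form on `V`. -/

section Local

variable {V : Type*} [NormedAddCommGroup V] [NormedSpace ℝ V]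

/-- Christoffel symbols of the first kind:
`christoffelFirst G x u v w = (∂_u G(v,w) + ∂_v G(u,w) - ∂_w G(u,v)) / 2` at `x`. -/
def christoffelFirst (G : V → V →L[ℝ] V →L[ℝ] ℝ) (x u : V) : V →L[ℝ] V →L[ℝ] ℝ :=
  (1 / 2 : ℝ) • (fderiv ℝ G x u + (fderiv ℝ G x).flip u - ((fderiv ℝ G x).flip u).flip)

theorem christoffelFirst_apply (G : V → V →L[ℝ] V →L[ℝ] ℝ) (x u v w : V) :
    christoffelFirst G x u v w =
      (fderiv ℝ G x u v w + fderiv ℝ G x v u w - fderiv ℝ G x w u v) / 2 := by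
  simp [christoffelFirst]
  ring

/-- Christoffel symbols of the second kind: `christoffel G x u v` is the vector `Γ(u,v)` with
`G x (Γ(u,v)) w = christoffelFirst G x u v w` for all `w`, obtained by inverting
`G x : V → (V →L[ℝ] ℝ)`. It is symmetric in `u` and `v` when `G` is symmetric. -/
def christoffel (G : V → V →L[ℝ] V →L[ℝ] ℝ) (x u : V) : V →L[ℝ] V :=
  (ContinuousLinearMap.inverse (G x)).comp (christoffelFirst G x u)

/-- The defining property of the Christoffel symbols, where `G x` is nondegenerate. -/
theorem christoffel_spec (G : V → V →L[ℝ] V →L[ℝ] ℝ) (x : V) (hG : (G x).IsInvertible)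
    (u v w : V) : G x (christoffel G x u v) w = christoffelFirst G x u v w := by
  obtain ⟨A, hA⟩ := hG
  simp [christoffel, ← hA]

/-- The covariant derivative `∇_u X = D_u X + Γ(X, u)` of a vector field. -/
def covDeriv (G : V → V →L[ℝ] V →L[ℝ] ℝ) (X : V → V) (x u : V) : V :=
  fderiv ℝ X x u + christoffel G x (X x) u

/-- The Hessian `(∇ df)(u, v) = D²f(u, v) - df(Γ(u, v))` of a function. -/
def hess (G : V → V →L[ℝ] V →L[ℝ] ℝ) (f : V → ℝ) (x u v : V) : ℝ :=
  fderiv ℝ (fderiv ℝ f) x u v - fderiv ℝ f x (christoffel G x u v)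

/-- The curvature `R(u, v) w = ∇_u ∇_v w - ∇_v ∇_u w - ∇_[u,v] w`, that is
`(D_u Γ)(w, v) - (D_v Γ)(w, u) + Γ(Γ(w, v), u) - Γ(Γ(w, u), v)`. -/
def curvature (G : V → V →L[ℝ] V →L[ℝ] ℝ) (x u v w : V) : V :=
  fderiv ℝ (fun y => christoffel G y w) x u v - fderiv ℝ (fun y => christoffel G y w) x v u
    + christoffel G x (christoffel G x w v) u - christoffel G x (christoffel G x w u) v

theorem christoffel_add (G : V → V →L[ℝ] V →L[ℝ] ℝ) (x u u' : V) :
    christoffel G x (u + u') = christoffel G x u + christoffel G x u' := by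
  ext v
  simp only [christoffel, ContinuousLinearMap.comp_apply, add_apply, ← map_add]
  congr 1
  ext w
  simp [christoffelFirst_apply]
  ring

theorem christoffel_smul (G : V → V →L[ℝ] V →L[ℝ] ℝ) (x u : V) (c : ℝ) :
    christoffel G x (c • u) = c • christoffel G x u := by
  ext v
  simp only [christoffel, ContinuousLinearMap.comp_apply, smul_apply,
    ← map_smul]
  congr 1
  ext w
  simp [christoffelFirst_apply]
  ring

/-- The linear map `u ↦ R(u, v) w`. -/
def curvatureMap (G : V → V →L[ℝ] V →L[ℝ] ℝ) (x v w : V) : V →ₗ[ℝ] V where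
  toFun u := curvature G x u v w
  map_add' a b := by
    simp only [curvature, map_add, christoffel_add, add_apply]
    abel
  map_smul' c a := by
    simp [curvature, christoffel_smul, smul_sub, smul_add]

/-- The Ricci tensor `S(v, w) = tr (u ↦ R(u, v) w)`. -/
def ricci (G : V → V →L[ℝ] V →L[ℝ] ℝ) (x v w : V) : ℝ :=
  LinearMap.trace ℝ V (curvatureMap G x v w)

end Local

/-! ### Semi-Riemannian calculus on a manifold without boundary

A metric `g` gives a bilinear form on each tangent space. Its covariant derivative, Hessian and
Ricci tensor at `p` are computed in a chart `e` around `p`. They do not depend on the chart; an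
equation between them is required to hold in every chart of the atlas. -/

section Manifold

variable {E : Type*} [NormedAddCommGroup E] [NormedSpace ℝ E]
  {H : Type*} [TopologicalSpace H] (I : ModelWithCorners ℝ E H)
  {M : Type*} [TopologicalSpace M] [ChartedSpace H M]

/-- Components in the chart `e` of a tangent vector at `p`. -/
def chartVec (e : OpenPartialHomeomorph M H) (p : M) : TangentSpace I p →L[ℝ] E :=
  mfderiv I 𝓘(ℝ, E) (e.extend I) p

/-- The tangent vector at the point with coordinates `y` whose components in the chart `e` are
given. -/
def chartVecSymm (e : OpenPartialHomeomorph M H) (y : E) :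
    E →L[ℝ] TangentSpace I ((e.extend I).symm y) :=
  mfderiv 𝓘(ℝ, E) I (e.extend I).symm y

/-- The metric in the chart `e`. -/
def metricIn (g : ∀ p : M, TangentSpace I p →L[ℝ] TangentSpace I p →L[ℝ] ℝ)
    (e : OpenPartialHomeomorph M H) (y : E) : E →L[ℝ] E →L[ℝ] ℝ :=
  let gy : E →L[ℝ] E →L[ℝ] ℝ := g ((e.extend I).symm y)
  let D : E →L[ℝ] E := chartVecSymm I e y
  gy.bilinearComp D D

theorem metricIn_apply (g : ∀ p : M, TangentSpace I p →L[ℝ] TangentSpace I p →L[ℝ] ℝ)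
    (e : OpenPartialHomeomorph M H) (y u v : E) :
    metricIn I g e y u v =
      g ((e.extend I).symm y) (chartVecSymm I e y u) (chartVecSymm I e y v) := rfl

/-- A vector field in the chart `e`. -/
def fieldIn (X : ∀ p : M, TangentSpace I p) (e : OpenPartialHomeomorph M H) (y : E) : E :=
  chartVec I e ((e.extend I).symm y) (X ((e.extend I).symm y))

/-- Components in the chart `e` of the covariant derivative `∇_u X` at `p`. -/
def covDerivIn (g : ∀ p : M, TangentSpace I p →L[ℝ] TangentSpace I p →L[ℝ] ℝ)
    (X : ∀ p : M, TangentSpace I p) (e : OpenPartialHomeomorph M H) (p : M)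
    (u : TangentSpace I p) : E :=
  covDeriv (metricIn I g e) (fieldIn I X e) (e.extend I p) (chartVec I e p u)

/-- The Hessian of `f` at `p`, computed in the chart `e`. -/
def hessIn (g : ∀ p : M, TangentSpace I p →L[ℝ] TangentSpace I p →L[ℝ] ℝ)
    (f : M → ℝ) (e : OpenPartialHomeomorph M H) (p : M) (u v : TangentSpace I p) : ℝ :=
  hess (metricIn I g e) (fun y => f ((e.extend I).symm y)) (e.extend I p)
    (chartVec I e p u) (chartVec I e p v)

/-- The Ricci tensor at `p`, computed in the chart `e`. -/
def ricciIn (g : ∀ p : M, TangentSpace I p →L[ℝ] TangentSpace I p →L[ℝ] ℝ)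
    (e : OpenPartialHomeomorph M H) (p : M) (u v : TangentSpace I p) : ℝ :=
  ricci (metricIn I g e) (e.extend I p) (chartVec I e p u) (chartVec I e p v)

/-- `ρ` is torse-forming: `∇_u ρ = om(u) ρ + ψ u` for a smooth function `ψ` and a 1-form `om`.
(Where `ρ` does not vanish and is smooth, `om` is smooth automatically.) -/
def IsTorseForming (g : ∀ p : M, TangentSpace I p →L[ℝ] TangentSpace I p →L[ℝ] ℝ)
    (ρ : ∀ p : M, TangentSpace I p) : Prop :=
  ∃ (ψ : M → ℝ) (om : ∀ p : M, TangentSpace I p →L[ℝ] ℝ), ContMDiff I 𝓘(ℝ, ℝ) ∞ ψ ∧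
    ∀ e ∈ atlas H M, ∀ p ∈ e.source, ∀ u : TangentSpace I p,
      covDerivIn I g ρ e p u = chartVec I e p (om p u • ρ p + ψ p • u)

/-- `S(u, ρ) = ξ η(u)`, where `η = g(·, ρ)`: the field `ρ` is an eigenvector of the Ricci tensor
with eigenvalue `ξ`. -/
def IsRicciEigenfield (g : ∀ p : M, TangentSpace I p →L[ℝ] TangentSpace I p →L[ℝ] ℝ)
    (ρ : ∀ p : M, TangentSpace I p) (ξ : M → ℝ) : Prop :=
  ∀ e ∈ atlas H M, ∀ p ∈ e.source, ∀ u : TangentSpace I p,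
    ricciIn I g e p u (ρ p) = ξ p * g p u (ρ p)

/-- `ρ` is a smooth unit timelike torse-forming vector field which is an eigenvector of the Ricci
tensor with eigenvalue `ξ`. -/
structure IsTorseFormingEigenfield [IsManifold I ∞ M]
    (g : ∀ p : M, TangentSpace I p →L[ℝ] TangentSpace I p →L[ℝ] ℝ)
    (ρ : ∀ p : M, TangentSpace I p) (ξ : M → ℝ) : Prop where
  smooth : ContMDiff I I.tangent ∞ (fun p => (⟨p, ρ p⟩ : TangentBundle I M))
  unit_timelike : ∀ p, g p (ρ p) (ρ p) = -1
  torse_forming : IsTorseForming I g ρ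
  eigen : IsRicciEigenfield I g ρ ξ

/-- The gradient Ricci soliton equation `Hess f + S + lam g = 0`, with smooth potential `f` and
real constant `lam`. -/
structure IsGradientRicciSoliton
    (g : ∀ p : M, TangentSpace I p →L[ℝ] TangentSpace I p →L[ℝ] ℝ)
    (f : M → ℝ) (lam : ℝ) : Prop where
  smooth : ContMDiff I 𝓘(ℝ, ℝ) ∞ f
  equation : ∀ e ∈ atlas H M, ∀ p ∈ e.source, ∀ u v : TangentSpace I p,
    hessIn I g f e p u v + ricciIn I g e p u v + lam * g p u v = 0

/-- Perfect-fluid spacetime with velocity field `ρ`: the field `ρ` is unit timelike, the Ricci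
tensor `S` does not vanish, and `S = a₁ g + b₁ η ⊗ η` with smooth `a₁`, `b₁` and `η = g(·, ρ)`. -/
structure IsPerfectFluid
    (g : ∀ p : M, TangentSpace I p →L[ℝ] TangentSpace I p →L[ℝ] ℝ)
    (ρ : ∀ p : M, TangentSpace I p) : Prop where
  unit_timelike : ∀ p, g p (ρ p) (ρ p) = -1
  ricci_ne_zero : ∀ e ∈ atlas H M, ∀ p ∈ e.source, ∃ u v : TangentSpace I p,
    ricciIn I g e p u v ≠ 0
  ricci_eq : ∃ a₁ b₁ : M → ℝ, ContMDiff I 𝓘(ℝ, ℝ) ∞ a₁ ∧ ContMDiff I 𝓘(ℝ, ℝ) ∞ b₁ ∧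
    ∀ e ∈ atlas H M, ∀ p ∈ e.source, ∀ u v : TangentSpace I p,
      ricciIn I g e p u v = a₁ p * g p u v + b₁ p * (g p u (ρ p) * g p v (ρ p))

end Manifold

/-! ### Generalized Robertson-Walker spacetimes -/

section Warped

variable {m : ℕ} (J : Opens ℝ) {N : Type*} [TopologicalSpace N]
  [ChartedSpace (EuclideanSpace ℝ (Fin m)) N]

/-- Model of the product `J × N` of an open interval and an `m`-dimensional manifold. -/
abbrev model (m : ℕ) : ModelWithCorners ℝ (ℝ × EuclideanSpace ℝ (Fin m))
    (ModelProd ℝ (EuclideanSpace ℝ (Fin m))) :=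
  𝓘(ℝ, ℝ).prod (𝓡 m)

/-- The warped metric `-dt² + a(t)² h` on `J × N`. -/
def warpedMetric [IsManifold (𝓡 m) ∞ N]
    (h : ContMDiffRiemannianMetric (𝓡 m) ∞ (EuclideanSpace ℝ (Fin m))
      (fun x : N => TangentSpace (𝓡 m) x)) (a : ℝ → ℝ) (p : J × N) :
    TangentSpace (model m) p →L[ℝ] TangentSpace (model m) p →L[ℝ] ℝ :=
  let F := EuclideanSpace ℝ (Fin m)
  let dt : ℝ × F →L[ℝ] ℝ := ContinuousLinearMap.fst ℝ ℝ F
  let pr : ℝ × F →L[ℝ] F := ContinuousLinearMap.snd ℝ ℝ F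
  let hp : F →L[ℝ] F →L[ℝ] ℝ := h.inner p.2
  (a p.1) ^ 2 • (hp.bilinearComp pr pr) - (ContinuousLinearMap.mul ℝ ℝ).bilinearComp dt dt

theorem warpedMetric_apply [IsManifold (𝓡 m) ∞ N]
    (h : ContMDiffRiemannianMetric (𝓡 m) ∞ (EuclideanSpace ℝ (Fin m))
      (fun x : N => TangentSpace (𝓡 m) x)) (a : ℝ → ℝ) (p : J × N)
    (s t : ℝ) (v w : TangentSpace (𝓡 m) p.2) :
    warpedMetric J h a p (s, v) (t, w) = a p.1 ^ 2 * h.inner p.2 v w - s * t := rfl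

/-- The coordinate vector field `∂_t` on `J × N`. -/
def timeField (p : J × N) : TangentSpace (model m) p :=
  ((1, 0) : ℝ × EuclideanSpace ℝ (Fin m))

end Warped

end GRW

end

/-! Differentiating $g(\rho,\rho)=-1$ forces $\omega=\psi\eta$, so
$\nabla_U\rho=\psi\,(U+\eta(U)\rho)$ (`covDeriv_eq`). Since $\rho f=c$ is constant,
$\operatorname{Hess}f(\rho,U)=-df(\nabla_U\rho)=-\psi\,(df(U)+c\,\eta(U))$, which vanishes for
$U=\rho$. The soliton equation on $(\rho,\rho)$ then gives $\xi=-\lambda_1$ (`eigenvalue_eq`): the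
eigenvalue is constant, so non-zero at one point means non-zero everywhere. On $(U,\rho)$ it leaves
$\psi\,(df+c\,\eta)=0$.

Where $\psi\ne0$, hence on an open set, $df=-c\,\eta$. Differentiating once more gives
$\operatorname{Hess}f=-c\psi\,(g+\eta\otimes\eta)$ (`hess_of_ne_zero`), so
$S=(c\psi-\lambda_1)g+c\psi\,\eta\otimes\eta$. If $\psi$ vanished on an open set, $\rho$ would be
parallel there, the curvature would annihilate it and $\xi$ would be $0$ (`eigenvalue_eq_zero`). So
$\psi\neq0$ on a dense set, and continuity extends the formula to every point (`ricci_eq`). Finally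
$S(\rho,\rho)=\lambda_1\neq0$.

The warped product enters (b) only as a smooth nondegenerate metric. For (a),
$\nabla_U\partial_t=H\,(U-dt(U)\,\partial_t)$ with $H=a'/a$ (`christoffel_warpedForm`), and tracing
the resulting curvature gives the Ricci eigenvalue (`ricci_warpedForm`). -/

noncomputable section

namespace GRW

/-! ### Levi-Civita calculus on an open subset of a vector space. -/

section LocalCalculus

variable {V : Type*} [NormedAddCommGroup V] [NormedSpace ℝ V]

/-- `G` is a smooth semi-Riemannian metric on the open set `s`. -/
structure IsMetricOn (G : V → V →L[ℝ] V →L[ℝ] ℝ) (s : Set V) : Prop where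
  isOpen : IsOpen s
  contDiffOn : ContDiffOn ℝ ∞ G s
  symm : ∀ x ∈ s, ∀ u v, G x u v = G x v u
  isInvertible : ∀ x ∈ s, (G x).IsInvertible

/-- On a finite-dimensional space a form without kernel is invertible. -/
theorem isInvertible_of_ker [FiniteDimensional ℝ V] {B : V →L[ℝ] V →L[ℝ] ℝ}
    (hB : ∀ u, (∀ v, B u v = 0) → u = 0) : B.IsInvertible := by
  have hinj : Function.Injective (B : V →ₗ[ℝ] V →L[ℝ] ℝ) := by
    rw [← LinearMap.ker_eq_bot, LinearMap.ker_eq_bot']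
    intro u hu
    refine hB u fun v => ?_
    have : B u = 0 := hu
    simp [this]
  have hfin : Module.finrank ℝ V = Module.finrank ℝ (V →L[ℝ] ℝ) := by
    rw [← (LinearMap.toContinuousLinearMap (E := V) (F' := ℝ) (𝕜 := ℝ)).finrank_eq]
    exact (Subspace.dual_finrank_eq (K := ℝ) (V := V)).symm
  let A : V ≃ₗ[ℝ] (V →L[ℝ] ℝ) := LinearEquiv.ofInjectiveOfFinrankEq _ hinj hfin
  exact ⟨A.toContinuousLinearEquiv, by ext u v; rfl⟩

theorem two_le_infty : minSmoothness ℝ 2 ≤ (∞ : WithTop ℕ∞) := by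
  rw [minSmoothness_of_isRCLikeNormedField]
  exact WithTop.coe_le_coe.2 (le_top : (2 : ℕ∞) ≤ ⊤)

variable {G : V → V →L[ℝ] V →L[ℝ] ℝ} {s : Set V} {x : V}

namespace IsMetricOn

theorem contDiffAt (hG : IsMetricOn G s) (hx : x ∈ s) : ContDiffAt ℝ ∞ G x :=
  hG.contDiffOn.contDiffAt (hG.isOpen.mem_nhds hx)

theorem differentiableAt (hG : IsMetricOn G s) (hx : x ∈ s) : DifferentiableAt ℝ G x :=
  (hG.contDiffAt hx).differentiableAt (by simp)

theorem contDiffOn_fderiv (hG : IsMetricOn G s) : ContDiffOn ℝ ∞ (fderiv ℝ G) s :=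
  hG.contDiffOn.fderiv_of_isOpen hG.isOpen (by simp)

theorem fderiv_apply₂ (hG : IsMetricOn G s) (hx : x ∈ s) (u v w : V) :
    fderiv ℝ (fun y => G y v w) x u = fderiv ℝ G x u v w := by
  have h1 := ((hG.differentiableAt hx).hasFDerivAt.clm_apply (hasFDerivAt_const v x)).clm_apply
    (hasFDerivAt_const w x)
  simp [h1.fderiv]

theorem fderiv_symm (hG : IsMetricOn G s) (hx : x ∈ s) (u v w : V) :
    fderiv ℝ G x u v w = fderiv ℝ G x u w v := by
  rw [← hG.fderiv_apply₂ hx, ← hG.fderiv_apply₂ hx]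
  congr 1
  refine Filter.EventuallyEq.fderiv_eq ?_
  filter_upwards [hG.isOpen.mem_nhds hx] with y hy using hG.symm y hy v w

theorem contDiffOn_christoffelFirst (hG : IsMetricOn G s) (u : V) :
    ContDiffOn ℝ ∞ (fun y => christoffelFirst G y u) s := by
  have h1 := hG.contDiffOn_fderiv
  have h2 : ContDiffOn ℝ ∞ (fun y => fderiv ℝ G y u) s := h1.clm_apply contDiffOn_const
  have h3 : ContDiffOn ℝ ∞ (fun y => (fderiv ℝ G y).flip u) s :=
    ((ContinuousLinearMap.flipₗᵢ ℝ V V (V →L[ℝ] ℝ)).contDiff.comp_contDiffOn h1).clm_apply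
      contDiffOn_const
  have h4 : ContDiffOn ℝ ∞ (fun y => ((fderiv ℝ G y).flip u).flip) s :=
    (ContinuousLinearMap.flipₗᵢ ℝ V V ℝ).contDiff.comp_contDiffOn h3
  exact ((h2.add h3).sub h4).const_smul (1 / 2 : ℝ)

/-- Operator inversion is smooth at invertible operators, so raising an index preserves smoothness.
-/
theorem contDiffOn_christoffel [CompleteSpace V] (hG : IsMetricOn G s) (u : V) :
    ContDiffOn ℝ ∞ (fun y => christoffel G y u) s := by
  have h1 : ContDiffOn ℝ ∞ (fun y => ContinuousLinearMap.inverse (G y)) s := fun y hy =>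
    ((hG.isInvertible y hy).contDiffAt_map_inverse.comp y (hG.contDiffAt hy)).contDiffWithinAt
  exact h1.clm_comp (hG.contDiffOn_christoffelFirst u)

theorem eq_of_forall (hG : IsMetricOn G s) (hx : x ∈ s) {u v : V}
    (h : ∀ w, G x u w = G x v w) : u = v := by
  obtain ⟨A, hA⟩ := hG.isInvertible x hx
  refine A.injective (ContinuousLinearMap.ext fun w => ?_)
  have := h w
  rw [← hA] at this
  exact this

/-- Torsion-freeness: exchanging the first two arguments only permutes terms of the Koszul formula,
up to the symmetry of the metric. -/
theorem christoffel_comm (hG : IsMetricOn G s) (hx : x ∈ s) (u v : V) :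
    christoffel G x u v = christoffel G x v u := by
  refine hG.eq_of_forall hx fun w => ?_
  rw [christoffel_spec _ _ (hG.isInvertible x hx), christoffel_spec _ _ (hG.isInvertible x hx),
    christoffelFirst_apply, christoffelFirst_apply, hG.fderiv_symm hx w u v]
  ring

/-- The Levi-Civita connection is compatible with the metric. -/
theorem fderiv_eq_christoffel (hG : IsMetricOn G s) (hx : x ∈ s) (u v w : V) :
    fderiv ℝ G x u v w = G x (christoffel G x v u) w + G x v (christoffel G x w u) := by
  rw [hG.symm x hx v, christoffel_spec _ _ (hG.isInvertible x hx),
    christoffel_spec _ _ (hG.isInvertible x hx), christoffelFirst_apply, christoffelFirst_apply,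
    hG.fderiv_symm hx u w v, hG.fderiv_symm hx w u v, hG.fderiv_symm hx v w u]
  ring

/-- `u (g(v, X)) = g(Γ(u, v), X) + g(v, ∇_u X)` for a constant vector `v`. -/
theorem fderiv_apply_field (hG : IsMetricOn G s) (hx : x ∈ s) {X : V → V}
    (hX : DifferentiableAt ℝ X x) (u v : V) :
    fderiv ℝ (fun y => G y v (X y)) x u =
      G x (christoffel G x u v) (X x) + G x v (covDeriv G X x u) := by
  have h1 := ((hG.differentiableAt hx).hasFDerivAt.clm_apply (hasFDerivAt_const v x)).clm_apply
    hX.hasFDerivAt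
  rw [h1.fderiv]
  simp [covDeriv, hG.fderiv_eq_christoffel hx u v (X x), hG.christoffel_comm hx u v]
  ring

/-- `u (g(X, X)) = 2 g(∇_u X, X)`. -/
theorem fderiv_apply_self (hG : IsMetricOn G s) (hx : x ∈ s) {X : V → V}
    (hX : DifferentiableAt ℝ X x) (u : V) :
    fderiv ℝ (fun y => G y (X y) (X y)) x u = 2 * G x (covDeriv G X x u) (X x) := by
  have h1 := ((hG.differentiableAt hx).hasFDerivAt.clm_apply hX.hasFDerivAt).clm_apply
    hX.hasFDerivAt
  rw [h1.fderiv]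
  simp only [add_apply, ContinuousLinearMap.comp_apply, ContinuousLinearMap.flip_apply,
    covDeriv, map_add, hG.fderiv_eq_christoffel hx u]
  rw [hG.symm x hx (X x) (fderiv ℝ X x u), hG.symm x hx (X x) (christoffel G x (X x) u)]
  ring

theorem hess_comm (hG : IsMetricOn G s) (hx : x ∈ s) {f : V → ℝ} (hf : ContDiffAt ℝ ∞ f x)
    (u v : V) : hess G f x u v = hess G f x v u := by
  have h1 : IsSymmSndFDerivAt ℝ f x := hf.isSymmSndFDerivAt two_le_infty
  rw [hess, hess, hG.christoffel_comm hx, h1.eq]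

theorem continuousAt_hess [CompleteSpace V] (hG : IsMetricOn G s) (hx : x ∈ s) {f : V → ℝ}
    (hf : ContDiffOn ℝ ∞ f s) (u v : V) : ContinuousAt (fun y => hess G f y u v) x := by
  have h1 : ContDiffOn ℝ ∞ (fderiv ℝ f) s := hf.fderiv_of_isOpen hG.isOpen (by simp)
  have h2 : ContDiffOn ℝ ∞ (fderiv ℝ (fderiv ℝ f)) s := h1.fderiv_of_isOpen hG.isOpen (by simp)
  have h3 : ContDiffOn ℝ ∞ (fun y => fderiv ℝ (fderiv ℝ f) y u v) s :=
    (h2.clm_apply contDiffOn_const).clm_apply contDiffOn_const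
  have h4 : ContDiffOn ℝ ∞ (fun y => fderiv ℝ f y (christoffel G y u v)) s :=
    h1.clm_apply ((hG.contDiffOn_christoffel u).clm_apply contDiffOn_const)
  exact (h3.sub h4).continuousOn.continuousAt (hG.isOpen.mem_nhds hx)

end IsMetricOn

/-- `(∇ df)(X, u) = u (X f) - (∇_u X) f`. -/
theorem hess_field_left {f : V → ℝ} {X : V → V} (hf : ContDiffAt ℝ ∞ f x)
    (hX : DifferentiableAt ℝ X x) (u : V) :
    hess G f x (X x) u =
      fderiv ℝ (fun y => fderiv ℝ f y (X y)) x u - fderiv ℝ f x (covDeriv G X x u) := by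
  have h1 : IsSymmSndFDerivAt ℝ f x := hf.isSymmSndFDerivAt two_le_infty
  have h2 : DifferentiableAt ℝ (fderiv ℝ f) x :=
    (hf.fderiv_right (m := ∞) (by simp)).differentiableAt (by simp)
  rw [(h2.hasFDerivAt.clm_apply hX.hasFDerivAt).fderiv, hess, h1.eq]
  simp [covDeriv]

/-- The Christoffel symbols as a continuous bilinear map. -/
def christoffelBilin [FiniteDimensional ℝ V] (G : V → V →L[ℝ] V →L[ℝ] ℝ) (x : V) :
    V →L[ℝ] V →L[ℝ] V :=
  LinearMap.toContinuousLinearMap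
    { toFun := christoffel G x
      map_add' := christoffel_add G x
      map_smul' := fun c u => christoffel_smul G x u c }

theorem christoffelBilin_apply [FiniteDimensional ℝ V] (x u : V) :
    christoffelBilin G x u = christoffel G x u := rfl

/-- A parallel vector field is annihilated by the curvature. -/
theorem IsMetricOn.curvature_eq_zero_of_parallel [FiniteDimensional ℝ V] (hG : IsMetricOn G s)
    (hx : x ∈ s) {X : V → V} (hX : ContDiffAt ℝ ∞ X x)
    (hpar : ∀ᶠ y in nhds x, ∀ u, covDeriv G X y u = 0) (u v : V) :
    curvature G x u v (X x) = 0 := by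
  have := FiniteDimensional.complete ℝ V
  -- Smoothness of $\Gamma$ as a bilinear map is needed because both the base point and the argument
  -- of $\Gamma_y(X(y))$ vary.
  have hB : ContDiffOn ℝ ∞ (christoffelBilin G) s :=
    contDiffOn_clm_apply.2 fun w => hG.contDiffOn_christoffel w
  have hB' : HasFDerivAt (christoffelBilin G) (fderiv ℝ (christoffelBilin G) x) x :=
    ((hB.contDiffAt (hG.isOpen.mem_nhds hx)).differentiableAt (by simp)).hasFDerivAt
  have hX' : HasFDerivAt X (fderiv ℝ X x) x := (hX.differentiableAt (by simp)).hasFDerivAt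
  -- Being parallel is the system $DX=-\Gamma(X)$. The symmetry of $D^2X$ is its integrability
  -- condition, which is exactly $R(u,v)X=0$.
  have hD : fderiv ℝ X =ᶠ[nhds x] fun y => -christoffelBilin G y (X y) := by
    filter_upwards [hpar] with y hy
    ext u
    have := hy u
    rw [covDeriv] at this
    simp [christoffelBilin_apply, eq_neg_of_add_eq_zero_left this]
  have hsym : IsSymmSndFDerivAt ℝ X x := hX.isSymmSndFDerivAt two_le_infty
  have h2 : ∀ u, fderiv ℝ (fderiv ℝ X) x u = -(fderiv ℝ (christoffelBilin G) x u (X x) +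
      christoffelBilin G x (fderiv ℝ X x u)) := by
    intro u
    rw [hD.fderiv_eq, (hB'.clm_apply hX').fun_neg.fderiv]
    simp [add_comm]
  have h3 : fderiv ℝ (fun y => christoffel G y (X x)) x =
      (fderiv ℝ (christoffelBilin G) x).flip (X x) := by
    have := (hB'.clm_apply (hasFDerivAt_const (X x) x)).fderiv
    simp only [christoffelBilin_apply] at this
    rw [this]
    ext; simp
  have h4 := hsym.eq u v
  have h5 : ∀ u, fderiv ℝ X x u = -christoffel G x (X x) u := fun u => by
    rw [hD.self_of_nhds]; rfl
  rw [h2, h2, h5, h5] at h4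
  simp only [neg_apply, add_apply, christoffelBilin_apply, map_neg] at h4
  simp only [curvature, h3, ContinuousLinearMap.flip_apply]
  rw [← sub_eq_zero] at h4
  rw [← neg_eq_zero, ← h4]
  abel

end LocalCalculus

/-! ### The soliton argument in one coordinate domain. -/

section LocalSoliton

variable {V : Type*} [NormedAddCommGroup V] [NormedSpace ℝ V]

/-- A gradient Ricci soliton on an open subset of a vector space, with potential `F`, together
with a unit timelike torse-forming field `X` along which `F` has constant derivative `c`, and
which is an eigenfield of the Ricci tensor. -/
structure IsTorseFormingSolitonOn (G : V → V →L[ℝ] V →L[ℝ] ℝ) (s : Set V) (X : V → V)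
    (Ψ Ξ F : V → ℝ) (lam c : ℝ) : Prop where
  metric : IsMetricOn G s
  contDiffOn_field : ContDiffOn ℝ ∞ X s
  contDiffOn_potential : ContDiffOn ℝ ∞ F s
  continuousOn : ContinuousOn Ψ s
  unit_timelike : ∀ x ∈ s, G x (X x) (X x) = -1
  torse_forming : ∀ x ∈ s, ∃ om : V → ℝ, ∀ u, covDeriv G X x u = om u • X x + Ψ x • u
  eigen : ∀ x ∈ s, ∀ u, ricci G x u (X x) = Ξ x * G x u (X x)
  soliton : ∀ x ∈ s, ∀ u v, hess G F x u v + ricci G x u v + lam * G x u v = 0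
  fderiv_field : ∀ x ∈ s, fderiv ℝ F x (X x) = c

namespace IsTorseFormingSolitonOn

variable {G : V → V →L[ℝ] V →L[ℝ] ℝ} {s : Set V} {X : V → V} {Ψ Ξ F : V → ℝ} {lam c : ℝ} {x : V}

theorem contDiffAt_field (h : IsTorseFormingSolitonOn G s X Ψ Ξ F lam c) (hx : x ∈ s) :
    ContDiffAt ℝ ∞ X x :=
  h.contDiffOn_field.contDiffAt (h.metric.isOpen.mem_nhds hx)

theorem differentiableAt_field (h : IsTorseFormingSolitonOn G s X Ψ Ξ F lam c) (hx : x ∈ s) :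
    DifferentiableAt ℝ X x :=
  (h.contDiffAt_field hx).differentiableAt (by simp)

theorem contDiffAt_potential (h : IsTorseFormingSolitonOn G s X Ψ Ξ F lam c) (hx : x ∈ s) :
    ContDiffAt ℝ ∞ F x :=
  h.contDiffOn_potential.contDiffAt (h.metric.isOpen.mem_nhds hx)

/-- `∇_u X = ψ (u + η(u) X)`. -/
theorem covDeriv_eq (h : IsTorseFormingSolitonOn G s X Ψ Ξ F lam c) (hx : x ∈ s) (u : V) :
    covDeriv G X x u = Ψ x • (u + G x u (X x) • X x) := by
  have h1 := h.metric.fderiv_apply_self hx (h.differentiableAt_field hx) u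
  have h2 : fderiv ℝ (fun y => G y (X y) (X y)) x = 0 := by
    have : (fun y => G y (X y) (X y)) =ᶠ[nhds x] fun _ => -1 := by
      filter_upwards [h.metric.isOpen.mem_nhds hx] with y hy using h.unit_timelike y hy
    rw [this.fderiv_eq]
    simp
  obtain ⟨om, hom⟩ := h.torse_forming x hx
  rw [h2, hom u] at h1
  simp only [zero_apply, map_add, map_smul, add_apply, smul_apply, h.unit_timelike x hx,
    smul_eq_mul] at h1
  -- Pairing the torse-forming equation with $X$ kills the left side and determines the 1-form.
  have h3 : om u = Ψ x * G x u (X x) := by linarith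
  rw [hom u, h3, smul_add, smul_smul, add_comm]

theorem hess_field (h : IsTorseFormingSolitonOn G s X Ψ Ξ F lam c) (hx : x ∈ s) (u : V) :
    hess G F x (X x) u = -(Ψ x * (fderiv ℝ F x u + G x u (X x) * c)) := by
  rw [hess_field_left (h.contDiffAt_potential hx) (h.differentiableAt_field hx)]
  have h2 : fderiv ℝ (fun y => fderiv ℝ F y (X y)) x = 0 := by
    have : (fun y => fderiv ℝ F y (X y)) =ᶠ[nhds x] fun _ => c := by
      filter_upwards [h.metric.isOpen.mem_nhds hx] with y hy using h.fderiv_field y hy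
    rw [this.fderiv_eq]
    simp
  rw [h2, h.covDeriv_eq hx]
  simp [h.fderiv_field x hx]
  ring

/-- On $(X,X)$ the Hessian drops out, because $dF(X)=c$ and $\eta(X)=-1$ cancel in `hess_field`. -/
theorem eigenvalue_eq (h : IsTorseFormingSolitonOn G s X Ψ Ξ F lam c) (hx : x ∈ s) :
    Ξ x = -lam := by
  have h1 := h.soliton x hx (X x) (X x)
  rw [h.hess_field hx, h.eigen x hx, h.unit_timelike x hx, h.fderiv_field x hx] at h1
  linarith

/-- On $(u,X)$ the Ricci and metric terms cancel by `eigenvalue_eq`, so the Hessian term alone must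
vanish and $\Psi$ can be divided out. -/
theorem fderiv_potential (h : IsTorseFormingSolitonOn G s X Ψ Ξ F lam c) (hx : x ∈ s)
    (hΨ : Ψ x ≠ 0) (u : V) : fderiv ℝ F x u = -c * G x u (X x) := by
  have h1 := h.soliton x hx u (X x)
  rw [h.metric.hess_comm hx (h.contDiffAt_potential hx), h.hess_field hx, h.eigen x hx,
    h.eigenvalue_eq hx] at h1
  have h2 : Ψ x * (fderiv ℝ F x u + G x u (X x) * c) = 0 := by linarith
  have := (mul_eq_zero.1 h2).resolve_left hΨ
  linarith

/-- By continuity $\Psi\neq0$ near $x$, so $dF=-c\,\eta$ may be differentiated there. The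
Christoffel terms cancel and $-c\,\nabla\eta$ remains. -/
theorem hess_of_ne_zero (h : IsTorseFormingSolitonOn G s X Ψ Ξ F lam c) (hx : x ∈ s)
    (hΨ : Ψ x ≠ 0) (u v : V) :
    hess G F x u v = -(c * Ψ x) * (G x u v + G x u (X x) * G x v (X x)) := by
  have hev : ∀ᶠ y in nhds x, y ∈ s ∧ Ψ y ≠ 0 :=
    (Filter.eventually_of_mem (h.metric.isOpen.mem_nhds hx) fun _ hy => hy).and
      ((h.continuousOn.continuousAt (h.metric.isOpen.mem_nhds hx)).eventually_ne hΨ)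
  have h1 : fderiv ℝ (fun y => fderiv ℝ F y v) x u = fderiv ℝ (fderiv ℝ F) x u v := by
    have h2 : DifferentiableAt ℝ (fderiv ℝ F) x :=
      ((h.contDiffAt_potential hx).fderiv_right (m := ∞) (by simp)).differentiableAt (by simp)
    simp [(h2.hasFDerivAt.clm_apply (hasFDerivAt_const v x)).fderiv]
  have h2 : (fun y => fderiv ℝ F y v) =ᶠ[nhds x] fun y => -c * G y v (X y) := by
    filter_upwards [hev] with y hy using h.fderiv_potential hy.1 hy.2 v
  have hd : DifferentiableAt ℝ (fun y => G y v (X y)) x :=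
    ((h.metric.differentiableAt hx).clm_apply (differentiableAt_const v)).clm_apply
      (h.differentiableAt_field hx)
  rw [hess, ← h1, h2.fderiv_eq, fderiv_const_mul hd, h.fderiv_potential hx hΨ, smul_apply,
    h.metric.fderiv_apply_field hx (h.differentiableAt_field hx), h.covDeriv_eq hx,
    h.metric.symm x hx u v]
  simp
  ring

/-- Here $X$ is parallel near $x$, so $u\mapsto R(u,X)X$ is zero and so is its trace. -/
theorem eigenvalue_eq_zero [FiniteDimensional ℝ V]
    (h : IsTorseFormingSolitonOn G s X Ψ Ξ F lam c) (hx : x ∈ s)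
    (hΨ : ∀ᶠ y in nhds x, Ψ y = 0) : Ξ x = 0 := by
  have hpar : ∀ᶠ y in nhds x, ∀ u, covDeriv G X y u = 0 := by
    filter_upwards [hΨ, h.metric.isOpen.mem_nhds hx] with y hy hys u
    rw [h.covDeriv_eq hys, hy, zero_smul]
  have h1 : curvatureMap G x (X x) (X x) = 0 := by
    ext u
    exact h.metric.curvature_eq_zero_of_parallel hx (h.contDiffAt_field hx) hpar u (X x)
  have h2 := h.eigen x hx (X x)
  rw [ricci, h1, map_zero, h.unit_timelike x hx] at h2
  linarith

/-- The Ricci tensor has the perfect fluid form. -/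
theorem ricci_eq [FiniteDimensional ℝ V] (h : IsTorseFormingSolitonOn G s X Ψ Ξ F lam c)
    (hlam : lam ≠ 0) (hx : x ∈ s) (u v : V) :
    ricci G x u v =
      (c * Ψ x - lam) * G x u v + c * Ψ x * (G x u (X x) * G x v (X x)) := by
  have := FiniteDimensional.complete ℝ V
  have hnhds := h.metric.isOpen.mem_nhds hx
  -- Points with $\Psi\neq0$ accumulate at $x$, since otherwise `eigenvalue_eq_zero` would force
  -- $\lambda=0$.
  have hfreq : ∃ᶠ y in nhds x, y ∈ s ∧ Ψ y ≠ 0 := by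
    intro hev
    refine hlam (neg_eq_zero.1 ?_)
    rw [← h.eigenvalue_eq hx]
    refine h.eigenvalue_eq_zero hx ?_
    filter_upwards [hev, hnhds] with y hy hys
    by_contra hne
    exact hy ⟨hys, hne⟩
  have hG := (h.metric.differentiableAt hx).continuousAt
  have hX := (h.differentiableAt_field hx).continuousAt
  have hc : ContinuousAt (fun y => hess G F y u v +
      c * Ψ y * (G y u v + G y u (X y) * G y v (X y))) x := by
    have hΨ := h.continuousOn.continuousAt hnhds
    have huX : ∀ w, ContinuousAt (fun y => G y w (X y)) x := fun w =>
      (hG.clm_apply continuousAt_const).clm_apply hX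
    exact (h.metric.continuousAt_hess hx h.contDiffOn_potential u v).add
      ((continuousAt_const.mul hΨ).mul
        (((hG.clm_apply continuousAt_const).clm_apply continuousAt_const).add
          ((huX u).mul (huX v))))
  -- A continuous expression that vanishes at points arbitrarily close to $x$ vanishes at $x$.
  have hz : hess G F x u v + c * Ψ x * (G x u v + G x u (X x) * G x v (X x)) = 0 := by
    by_contra hne
    obtain ⟨y, ⟨hys, hyΨ⟩, hy⟩ := (hfreq.and_eventually (hc.eventually_ne hne)).exists
    exact hy (by rw [h.hess_of_ne_zero hys hyΨ]; ring)
  linarith [h.soliton x hx u v]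

end IsTorseFormingSolitonOn

end LocalSoliton

/-! ### Passing between a manifold and its charts. -/

section Charts

variable {E : Type*} [NormedAddCommGroup E] [NormedSpace ℝ E]
  {H : Type*} [TopologicalSpace H] {I : ModelWithCorners ℝ E H}
  {M : Type*} [TopologicalSpace M] {e : OpenPartialHomeomorph M H}

theorem extend_symm_mem_source {y : E} (hy : y ∈ (e.extend I).target) :
    (e.extend I).symm y ∈ e.source := by
  rw [← e.extend_source (I := I)]
  exact (e.extend I).map_target hy

theorem exists_extend_symm_eq {p : M} (hp : p ∈ e.source) :
    ∃ y ∈ (e.extend I).target, (e.extend I).symm y = p :=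
  ⟨e.extend I p, (e.extend I).map_source (by rwa [e.extend_source]), e.extend_left_inv hp⟩

variable [ChartedSpace H M] [IsManifold I ∞ M]

theorem contMDiffOn_extend_of_mem_atlas (he : e ∈ atlas H M) :
    ContMDiffOn I 𝓘(ℝ, E) ∞ (e.extend I) e.source :=
  e.contMDiffOn_extend (IsManifold.subset_maximalAtlas he)

theorem contMDiffOn_extend_symm_of_mem_atlas (he : e ∈ atlas H M) :
    ContMDiffOn 𝓘(ℝ, E) I ∞ (e.extend I).symm (e.extend I).target := by
  rw [e.extend_target']
  exact contMDiffOn_extend_symm (IsManifold.subset_maximalAtlas he)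

theorem mdifferentiableAt_extend (he : e ∈ atlas H M) {p : M} (hp : p ∈ e.source) :
    MDifferentiableAt I 𝓘(ℝ, E) (e.extend I) p :=
  ((contMDiffOn_extend_of_mem_atlas he).contMDiffAt (e.open_source.mem_nhds hp)).mdifferentiableAt
    (by simp)

theorem contDiffOn_comp_extend_symm (he : e ∈ atlas H M) {f : M → ℝ}
    (hf : ContMDiff I 𝓘(ℝ, ℝ) ∞ f) :
    ContDiffOn ℝ ∞ (fun y => f ((e.extend I).symm y)) (e.extend I).target :=
  contMDiffOn_iff_contDiffOn.1 (hf.comp_contMDiffOn (contMDiffOn_extend_symm_of_mem_atlas he))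

/-- The coordinate expression is the fibre component of the tangent map of the chart, composed with
the section and the inverse chart. -/
theorem contDiffOn_fieldIn (he : e ∈ atlas H M) {X : ∀ p : M, TangentSpace I p}
    (hX : ContMDiff I I.tangent ∞ (fun p => (⟨p, X p⟩ : TangentBundle I M))) :
    ContDiffOn ℝ ∞ (fieldIn I X e) (e.extend I).target := by
  have h1 := (contMDiffOn_extend_of_mem_atlas (I := I) he).contMDiffOn_tangentMapWithin (m := ∞)
    (by simp) e.open_source.uniqueMDiffOn
  have h2 := hX.comp_contMDiffOn (contMDiffOn_extend_symm_of_mem_atlas (I := I) he)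
  have h3 := h1.comp h2 fun y hy => extend_symm_mem_source hy
  have h4 := (contMDiff_snd_tangentBundle_modelSpace E 𝓘(ℝ, E) (n := ∞)).comp_contMDiffOn h3
  refine (contMDiffOn_iff_contDiffOn.1 h4).congr fun y hy => ?_
  have hp := extend_symm_mem_source hy
  simp only [Function.comp, tangentMapWithin, fieldIn, chartVec]
  rw [mfderivWithin_of_isOpen e.open_source hp]
  rfl

variable [I.Boundaryless]

theorem mdifferentiableAt_extend_symm (he : e ∈ atlas H M) {y : E}
    (hy : y ∈ (e.extend I).target) :
    MDifferentiableAt 𝓘(ℝ, E) I (e.extend I).symm y :=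
  ((contMDiffOn_extend_symm_of_mem_atlas he).contMDiffAt
    (e.isOpen_extend_target.mem_nhds hy)).mdifferentiableAt (by simp)

/-- Chain rule for the chart after its inverse. Without boundary the target is open, so this
composite is the identity near $y$. -/
theorem chartVec_chartVecSymm (he : e ∈ atlas H M) {y : E} (hy : y ∈ (e.extend I).target)
    (u : E) : chartVec I e ((e.extend I).symm y) (chartVecSymm I e y u) = u := by
  have h1 := (mdifferentiableAt_extend (I := I) he (extend_symm_mem_source hy)).hasMFDerivAt
  have h2 := (mdifferentiableAt_extend_symm (I := I) he hy).hasMFDerivAt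
  have h3 := h1.comp y h2
  have h4 : (e.extend I ∘ (e.extend I).symm) =ᶠ[nhds y] id := by
    filter_upwards [e.isOpen_extend_target.mem_nhds hy] with z hz using (e.extend I).right_inv hz
  have h5 := (hasMFDerivAt_id (I := 𝓘(ℝ, E)) y).congr_of_eventuallyEq h4
  have h6 := hasMFDerivAt_unique h3 h5
  exact congrArg (fun L : E →L[ℝ] E => L u) h6

theorem chartVecSymm_chartVec (he : e ∈ atlas H M) {y : E} (hy : y ∈ (e.extend I).target)
    (u : TangentSpace I ((e.extend I).symm y)) :
    chartVecSymm I e y (chartVec I e ((e.extend I).symm y) u) = u := by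
  have hp := extend_symm_mem_source hy
  have hyp : e.extend I ((e.extend I).symm y) = y := (e.extend I).right_inv hy
  have h1 := (mdifferentiableAt_extend (I := I) he hp).hasMFDerivAt
  have h2 := (mdifferentiableAt_extend_symm (I := I) he (hyp.symm ▸ hy)).hasMFDerivAt
  have h3 := h2.comp _ h1
  have h4 : ((e.extend I).symm ∘ e.extend I) =ᶠ[nhds ((e.extend I).symm y)] id := by
    filter_upwards [e.open_source.mem_nhds hp] with z hz using e.extend_left_inv hz
  have h5 := (hasMFDerivAt_id (I := I) ((e.extend I).symm y)).congr_of_eventuallyEq h4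
  have h6 := congrArg (fun L : E →L[ℝ] E => L u) (hasMFDerivAt_unique h3 h5)
  -- The chain rule takes the derivative of the inverse chart at the image of the preimage of $y$;
  -- this moves it to $y$ itself.
  have h7 := congrArg (fun z => (mfderiv 𝓘(ℝ, E) I (e.extend I).symm z : E →L[ℝ] E)
    (chartVec I e ((e.extend I).symm y) u)) hyp
  exact h7.symm.trans h6

variable {g : ∀ p : M, TangentSpace I p →L[ℝ] TangentSpace I p →L[ℝ] ℝ}

theorem metricIn_chartVec (he : e ∈ atlas H M) {y : E} (hy : y ∈ (e.extend I).target)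
    (u v : TangentSpace I ((e.extend I).symm y)) :
    metricIn I g e y (chartVec I e ((e.extend I).symm y) u) (chartVec I e ((e.extend I).symm y) v) =
      g ((e.extend I).symm y) u v := by
  rw [metricIn_apply, chartVecSymm_chartVec he hy, chartVecSymm_chartVec he hy]

theorem fderiv_comp_extend_symm (he : e ∈ atlas H M) {f : M → ℝ}
    (hf : ContMDiff I 𝓘(ℝ, ℝ) ∞ f) {y : E} (hy : y ∈ (e.extend I).target)
    (u : TangentSpace I ((e.extend I).symm y)) :
    fderiv ℝ (fun z => f ((e.extend I).symm z)) y (chartVec I e ((e.extend I).symm y) u) =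
      mfderiv I 𝓘(ℝ, ℝ) f ((e.extend I).symm y) u := by
  have h1 : mfderiv 𝓘(ℝ, E) 𝓘(ℝ, ℝ) (f ∘ (e.extend I).symm) y =
      (mfderiv I 𝓘(ℝ, ℝ) f ((e.extend I).symm y)).comp (mfderiv 𝓘(ℝ, E) I (e.extend I).symm y) :=
    mfderiv_comp y (hf.mdifferentiableAt (by simp)) (mdifferentiableAt_extend_symm he hy)
  rw [mfderiv_eq_fderiv] at h1
  have h2 := congrArg (fun L : E →L[ℝ] ℝ => L (chartVec I e ((e.extend I).symm y) u)) h1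
  refine h2.trans ?_
  exact congrArg (mfderiv I 𝓘(ℝ, ℝ) f ((e.extend I).symm y)) (chartVecSymm_chartVec he hy u)

/-- The coordinate vector fields of a chart are smooth. -/
theorem contMDiffOn_chartVecSymm (he : e ∈ atlas H M) (u : E) :
    ContMDiffOn 𝓘(ℝ, E) I.tangent ∞
      (fun y => (⟨(e.extend I).symm y, chartVecSymm I e y u⟩ : TangentBundle I M))
      (e.extend I).target := by
  have h1 := (contMDiffOn_extend_symm_of_mem_atlas (I := I) he).contMDiffOn_tangentMapWithin
    (m := ∞) (by simp) e.isOpen_extend_target.uniqueMDiffOn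
  have h2 : ContMDiff 𝓘(ℝ, E) 𝓘(ℝ, E).tangent ∞ (fun y => (⟨y, u⟩ : TangentBundle 𝓘(ℝ, E) E)) :=
    contMDiff_vectorSpace_iff_contDiff.2 contDiff_const
  have h3 := h1.comp h2.contMDiffOn fun y hy => hy
  refine h3.congr fun y hy => ?_
  simp only [Function.comp, tangentMapWithin, chartVecSymm]
  rw [mfderivWithin_of_isOpen e.isOpen_extend_target hy]
  rfl

variable [FiniteDimensional ℝ E]

/-- Each chart carries an `IsTorseFormingSolitonOn` with the same $\lambda$ and $c$, so the
coefficients read off locally are global functions of $\psi$. -/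
theorem isPerfectFluid_of_isGradientRicciSoliton
    (hg : ∀ e ∈ atlas H M, IsMetricOn (metricIn I g e) (e.extend I).target)
    {ρ : ∀ p : M, TangentSpace I p} {ξ : M → ℝ} (hρ : IsTorseFormingEigenfield I g ρ ξ)
    (hξ : ∃ p, ξ p ≠ 0) {f : M → ℝ} {lam c : ℝ} (hf : IsGradientRicciSoliton I g f lam)
    (hc : ∀ p, mfderiv I 𝓘(ℝ, ℝ) f p (ρ p) = c) : IsPerfectFluid I g ρ := by
  obtain ⟨ψ, om, hψ, hom⟩ := hρ.torse_forming
  have key : ∀ e ∈ atlas H M, IsTorseFormingSolitonOn (metricIn I g e) (e.extend I).target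
      (fieldIn I ρ e) (fun y => ψ ((e.extend I).symm y)) (fun y => ξ ((e.extend I).symm y))
      (fun y => f ((e.extend I).symm y)) lam c := by
    intro e he
    refine ⟨hg e he, contDiffOn_fieldIn he hρ.smooth, contDiffOn_comp_extend_symm he hf.smooth,
      (contDiffOn_comp_extend_symm he hψ).continuousOn, fun y hy => ?_, fun y hy => ?_,
      fun y hy u => ?_, fun y hy u v => ?_, fun y hy => ?_⟩
    · exact (metricIn_chartVec he hy _ _).trans (hρ.unit_timelike _)
    · refine ⟨fun u => om ((e.extend I).symm y) (chartVecSymm I e y u), fun u => ?_⟩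
      have := hom e he _ (extend_symm_mem_source hy) (chartVecSymm I e y u)
      rw [covDerivIn, chartVec_chartVecSymm he hy, (e.extend I).right_inv hy, map_add, map_smul,
        map_smul, chartVec_chartVecSymm he hy] at this
      exact this
    · have := hρ.eigen e he _ (extend_symm_mem_source hy) (chartVecSymm I e y u)
      rw [ricciIn, chartVec_chartVecSymm he hy, (e.extend I).right_inv hy,
        ← metricIn_chartVec he hy, chartVec_chartVecSymm he hy] at this
      exact this
    · have := hf.equation e he _ (extend_symm_mem_source hy) (chartVecSymm I e y u)
        (chartVecSymm I e y v)
      rw [hessIn, ricciIn, chartVec_chartVecSymm he hy, chartVec_chartVecSymm he hy,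
        (e.extend I).right_inv hy] at this
      exact this
    · exact (fderiv_comp_extend_symm he hf.smooth hy _).trans (hc _)
  have hlam : ∀ p, ξ p = -lam := by
    intro p
    obtain ⟨y, hy, hyp⟩ := exists_extend_symm_eq (I := I) (mem_chart_source H p)
    rw [← hyp]
    exact (key _ (chart_mem_atlas H p)).eigenvalue_eq hy
  have hlam0 : lam ≠ 0 := by
    obtain ⟨p, hp⟩ := hξ
    rwa [hlam, neg_ne_zero] at hp
  -- The pair $(\rho,\rho)$ detects $S\ne0$, as $S(\rho,\rho)=-\xi=\lambda$.
  refine ⟨hρ.unit_timelike, fun e he p hp => ⟨ρ p, ρ p, ?_⟩, fun p => c * ψ p - lam,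
    fun p => c * ψ p, (contMDiff_const.mul hψ).sub contMDiff_const, contMDiff_const.mul hψ, ?_⟩
  · rw [hρ.eigen e he p hp, hρ.unit_timelike, hlam]
    simpa using hlam0
  · intro e he p hp u v
    obtain ⟨y, hy, rfl⟩ := exists_extend_symm_eq (I := I) hp
    have := (key e he).ricci_eq hlam0 hy (chartVec I e _ u) (chartVec I e _ v)
    rw [ricciIn, (e.extend I).right_inv hy, this, metricIn_chartVec he hy, fieldIn,
      metricIn_chartVec he hy, metricIn_chartVec he hy]

end Charts

/-! ### Connection and curvature of $-dt^2+a^2K$ in the time direction. -/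

section LocalWarped

variable {F : Type*} [NormedAddCommGroup F] [NormedSpace ℝ F]

/-- The form `-dt² + a(t)² K` on `ℝ × F`. -/
def warpedForm (a : ℝ → ℝ) (K : F → F →L[ℝ] F →L[ℝ] ℝ) (y : ℝ × F) :
    (ℝ × F) →L[ℝ] (ℝ × F) →L[ℝ] ℝ :=
  a y.1 ^ 2 • (K y.2).bilinearComp (ContinuousLinearMap.snd ℝ ℝ F)
    (ContinuousLinearMap.snd ℝ ℝ F) -
  (ContinuousLinearMap.mul ℝ ℝ).bilinearComp (ContinuousLinearMap.fst ℝ ℝ F)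
    (ContinuousLinearMap.fst ℝ ℝ F)

theorem warpedForm_apply (a : ℝ → ℝ) (K : F → F →L[ℝ] F →L[ℝ] ℝ) (y u v : ℝ × F) :
    warpedForm a K y u v = a y.1 ^ 2 * K y.2 u.2 v.2 - u.1 * v.1 := rfl

/-- The projection `(s, v) ↦ (0, v)` of `ℝ × F`. -/
def spatialProj (F : Type*) [NormedAddCommGroup F] [NormedSpace ℝ F] :
    (ℝ × F) →L[ℝ] (ℝ × F) :=
  (ContinuousLinearMap.inr ℝ ℝ F).comp (ContinuousLinearMap.snd ℝ ℝ F)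

theorem spatialProj_apply (u : ℝ × F) : spatialProj F u = (0, u.2) := rfl

theorem spatialProj_eq (u : ℝ × F) : spatialProj F u = u - u.1 • (1, 0) := by
  ext <;> simp [spatialProj_apply]

variable {a : ℝ → ℝ} {K : F → F →L[ℝ] F →L[ℝ] ℝ} {s : Set ℝ} {t : Set F}

theorem isMetricOn_warpedForm [FiniteDimensional ℝ F] (hs : IsOpen s) (ht : IsOpen t)
    (ha : ContDiffOn ℝ ∞ a s) (ha_pos : ∀ x ∈ s, 0 < a x) (hK : ContDiffOn ℝ ∞ K t)
    (hsymm : ∀ x ∈ t, ∀ u v, K x u v = K x v u)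
    (hpos : ∀ x ∈ t, ∀ u, u ≠ 0 → 0 < K x u u) :
    IsMetricOn (warpedForm a K) (s ×ˢ t) := by
  refine ⟨hs.prod ht, ?_, fun x hx u v => ?_, fun x hx => isInvertible_of_ker fun u hu => ?_⟩
  · refine contDiffOn_clm_apply.2 fun u => contDiffOn_clm_apply.2 fun v => ?_
    have h1 : ContDiffOn ℝ ∞ (fun y : ℝ × F => a y.1) (s ×ˢ t) :=
      ha.comp contDiffOn_fst fun y hy => hy.1
    have h2 : ContDiffOn ℝ ∞ (fun y : ℝ × F => K y.2) (s ×ˢ t) :=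
      hK.comp contDiffOn_snd fun y hy => hy.2
    exact ((h1.pow 2).mul ((h2.clm_apply contDiffOn_const).clm_apply contDiffOn_const)).sub
      contDiffOn_const
  · rw [warpedForm_apply, warpedForm_apply, hsymm _ hx.2, mul_comm u.1]
  -- Testing against $\partial_t$ kills the time component; testing against the spatial part of $u$
  -- kills that part by positivity.
  · have h1 := hu (1, 0)
    have h2 := hu (0, u.2)
    rw [warpedForm_apply] at h1 h2
    simp only [map_zero, mul_zero, mul_one, zero_sub, sub_zero, neg_eq_zero] at h1 h2
    have h3 := (mul_eq_zero.1 h2).resolve_left (pow_ne_zero 2 (ha_pos _ hx.1).ne')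
    have h4 : u.2 = 0 := by
      by_contra hne
      exact (hpos _ hx.2 _ hne).ne' h3
    exact Prod.ext h1 h4

/-- The logarithmic derivative of the warping function. -/
def hubble (a : ℝ → ℝ) (x : ℝ) : ℝ := deriv a x / a x

theorem contDiffOn_hubble (hs : IsOpen s) (ha : ContDiffOn ℝ ∞ a s)
    (ha_pos : ∀ x ∈ s, 0 < a x) : ContDiffOn ℝ ∞ (hubble a) s :=
  (ha.deriv_of_isOpen hs (by simp)).div ha fun x hx => (ha_pos x hx).ne'

/-- `∇_u ∂_t = (a' / a) (u - dt(u) ∂_t)`. -/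
theorem christoffel_warpedForm (hG : IsMetricOn (warpedForm a K) (s ×ˢ t)) (hs : IsOpen s)
    (ht : IsOpen t) (ha : ContDiffOn ℝ ∞ a s) (ha_pos : ∀ x ∈ s, 0 < a x)
    (hK : ContDiffOn ℝ ∞ K t) {y : ℝ × F} (hy : y ∈ s ×ˢ t) :
    christoffel (warpedForm a K) y (1, 0) = hubble a y.1 • spatialProj F := by
  refine ContinuousLinearMap.ext fun u => ?_
  refine hG.eq_of_forall hy fun w => ?_
  rw [christoffel_spec _ _ (hG.isInvertible y hy), christoffelFirst_apply]
  -- The pairing with $\partial_t$ has constant coefficients, so only the $t$-derivative of $G(u,w)$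
  -- survives in the Koszul formula.
  have hconst : ∀ u w, fderiv ℝ (warpedForm a K) y u (1, 0) w = 0 := by
    intro u w
    rw [← hG.fderiv_apply₂ hy]
    simp [warpedForm_apply]
  have hpos := ha_pos _ hy.1
  have h1 : HasFDerivAt (fun z : ℝ × F => a z.1)
      (deriv a y.1 • ContinuousLinearMap.fst ℝ ℝ F) y :=
    (((ha.contDiffAt (hs.mem_nhds hy.1)).differentiableAt
      (by simp)).hasDerivAt).comp_hasFDerivAt y hasFDerivAt_fst
  have h2 : HasFDerivAt (fun z : ℝ × F => K z.2 u.2 w.2)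
      (((fderiv ℝ K y.2).flip u.2).flip w.2 ∘L ContinuousLinearMap.snd ℝ ℝ F) y := by
    have h3 := ((hK.contDiffAt (ht.mem_nhds hy.2)).differentiableAt (by simp)).hasFDerivAt
    have h4 := (h3.clm_apply (hasFDerivAt_const u.2 y.2)).clm_apply (hasFDerivAt_const w.2 y.2)
    refine (h4.comp y hasFDerivAt_snd).congr_fderiv ?_
    ext <;> simp
  have h5 := ((h1.pow 2).mul h2).sub_const (u.1 * w.1)
  rw [hconst, hconst, ← hG.fderiv_apply₂ hy]
  have h6 : fderiv ℝ (fun z => warpedForm a K z u w) y = _ := h5.fderiv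
  rw [h6, warpedForm_apply]
  simp [spatialProj_apply, hubble]
  field_simp

theorem curvature_warpedForm (hG : IsMetricOn (warpedForm a K) (s ×ˢ t)) (hs : IsOpen s)
    (ht : IsOpen t) (ha : ContDiffOn ℝ ∞ a s) (ha_pos : ∀ x ∈ s, 0 < a x)
    (hK : ContDiffOn ℝ ∞ K t) {y : ℝ × F} (hy : y ∈ s ×ˢ t) (u v : ℝ × F) :
    curvature (warpedForm a K) y u v (1, 0) =
      (deriv (hubble a) y.1 + hubble a y.1 ^ 2) •
        (u.1 • spatialProj F v - v.1 • spatialProj F u) := by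
  have hΓ := christoffel_warpedForm hG hs ht ha ha_pos hK hy
  have h1 : (fun z => christoffel (warpedForm a K) z (1, 0)) =ᶠ[nhds y]
      fun z => hubble a z.1 • spatialProj F := by
    filter_upwards [hG.isOpen.mem_nhds hy] with z hz using
      christoffel_warpedForm hG hs ht ha ha_pos hK hz
  have h2 : HasFDerivAt (fun z : ℝ × F => hubble a z.1)
      (deriv (hubble a) y.1 • ContinuousLinearMap.fst ℝ ℝ F) y :=
    ((((contDiffOn_hubble hs ha ha_pos).contDiffAt (hs.mem_nhds hy.1)).differentiableAt
      (by simp)).hasDerivAt).comp_hasFDerivAt y hasFDerivAt_fst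
  have h3 := h2.smul_const (spatialProj F)
  -- Rewrites the spatial symbols through $\Gamma(p,q)$; these unknown terms then cancel by symmetry
  -- and $K$ leaves no trace.
  have h4 : ∀ p q : ℝ × F, christoffel (warpedForm a K) y (spatialProj F p) q =
      christoffel (warpedForm a K) y p q - (p.1 * hubble a y.1) • spatialProj F q := by
    intro p q
    rw [spatialProj_eq p, sub_eq_add_neg, ← neg_smul, christoffel_add, christoffel_smul, hΓ]
    simp [smul_smul, sub_eq_add_neg]
  rw [curvature, h1.fderiv_eq, h3.fderiv, hΓ]
  simp only [smul_apply, ContinuousLinearMap.smulRight_apply, christoffel_smul, h4,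
    hG.christoffel_comm hy u v, ContinuousLinearMap.coe_fst', smul_eq_mul]
  module

/-- `S(u, ∂_t) = -(dim F) (ψ' + ψ²) dt(u)` with `ψ = a' / a`. -/
theorem ricci_warpedForm [FiniteDimensional ℝ F] (hG : IsMetricOn (warpedForm a K) (s ×ˢ t))
    (hs : IsOpen s) (ht : IsOpen t) (ha : ContDiffOn ℝ ∞ a s) (ha_pos : ∀ x ∈ s, 0 < a x)
    (hK : ContDiffOn ℝ ∞ K t) {y : ℝ × F} (hy : y ∈ s ×ˢ t) (u : ℝ × F) :
    ricci (warpedForm a K) y u (1, 0) =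
      -(Module.finrank ℝ F * (deriv (hubble a) y.1 + hubble a y.1 ^ 2)) * u.1 := by
  have h1 : curvatureMap (warpedForm a K) y u (1, 0) =
      (deriv (hubble a) y.1 + hubble a y.1 ^ 2) •
        (LinearMap.toSpanSingleton ℝ (ℝ × F) (spatialProj F u) ∘ₗ LinearMap.fst ℝ ℝ F -
          u.1 • (LinearMap.inr ℝ ℝ F ∘ₗ LinearMap.snd ℝ ℝ F)) :=
    LinearMap.ext fun v => curvature_warpedForm hG hs ht ha ha_pos hK hy v u
  -- The rank-one part has trace zero because a spatial vector has no time component; the other part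
  -- contributes $\dim F$.
  have h2 : LinearMap.fst ℝ ℝ F ∘ₗ LinearMap.toSpanSingleton ℝ (ℝ × F) (spatialProj F u) = 0 := by
    ext
    simp [spatialProj_apply]
  rw [ricci, h1, map_smul, map_sub, map_smul, LinearMap.trace_comp_comm', h2,
    LinearMap.trace_comp_comm', LinearMap.snd_comp_inr, LinearMap.trace_id, map_zero]
  simp
  ring

end LocalWarped

/-! ### The fibre metric in charts. -/

section Riemannian

variable {F : Type*} [NormedAddCommGroup F] [NormedSpace ℝ F] [FiniteDimensional ℝ F]
  {H : Type*} [TopologicalSpace H] {I : ModelWithCorners ℝ F H} [I.Boundaryless]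
  {N : Type*} [TopologicalSpace N] [ChartedSpace H N] [IsManifold I ∞ N]

/-- In finite dimension it is enough to test constant vectors, and these give smooth sections along
the inverse chart. -/
theorem contDiffOn_metricIn_riemannian
    (h : ContMDiffRiemannianMetric I ∞ F (fun x : N => TangentSpace I x))
    {e : OpenPartialHomeomorph N H} (he : e ∈ atlas H N) :
    ContDiffOn ℝ ∞ (metricIn I h.inner e) (e.extend I).target := by
  refine contDiffOn_clm_apply.2 fun u => contDiffOn_clm_apply.2 fun v => ?_
  refine contMDiffOn_iff_contDiffOn.1 fun y hy => ?_
  have h1 : ContMDiffWithinAt 𝓘(ℝ, F) (I.prod 𝓘(ℝ)) ∞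
      (fun z => TotalSpace.mk' ℝ (E := Bundle.Trivial N ℝ) ((e.extend I).symm z)
        (h.inner ((e.extend I).symm z) (chartVecSymm I e z u) (chartVecSymm I e z v)))
      (e.extend I).target y := by
    apply ContMDiffWithinAt.clm_bundle_apply₂ (F₁ := F) (F₂ := F)
    · exact h.contMDiff.contMDiffAt.comp_contMDiffWithinAt y
        (contMDiffOn_extend_symm_of_mem_atlas he y hy)
    · exact contMDiffOn_chartVecSymm he u y hy
    · exact contMDiffOn_chartVecSymm he v y hy
  simp only [contMDiffWithinAt_totalSpace] at h1
  exact h1.2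

omit [FiniteDimensional ℝ F] in
theorem metricIn_riemannian_pos
    (h : ContMDiffRiemannianMetric I ∞ F (fun x : N => TangentSpace I x))
    {e : OpenPartialHomeomorph N H} (he : e ∈ atlas H N) {y : F} (hy : y ∈ (e.extend I).target)
    {u : F} (hu : u ≠ 0) : 0 < metricIn I h.inner e y u u := by
  rw [metricIn_apply]
  refine h.pos _ _ fun h0 => hu ?_
  rw [← chartVec_chartVecSymm he hy u, h0, map_zero]

end Riemannian

/-! ### Product charts and the warped metric. -/

section WarpedCharts

variable {m : ℕ} {J : Opens ℝ} {N : Type*} [TopologicalSpace N]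
  [ChartedSpace (EuclideanSpace ℝ (Fin m)) N]

/-- The charts of an open subset of $\mathbb R$ are restrictions of the identity, so time is the
same coordinate in all of them. -/
theorem extend_interval_apply {e : OpenPartialHomeomorph J ℝ} (he : e ∈ atlas ℝ J) (t : J) :
    e.extend 𝓘(ℝ, ℝ) t = t := by
  obtain ⟨x, rfl⟩ := Opens.chart_eq ⟨t⟩ he
  rfl

theorem coe_extend_interval_symm {e : OpenPartialHomeomorph J ℝ} (he : e ∈ atlas ℝ J) {t : ℝ}
    (ht : t ∈ (e.extend 𝓘(ℝ, ℝ)).target) : ((e.extend 𝓘(ℝ, ℝ)).symm t : ℝ) = t := by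
  rw [← extend_interval_apply he, (e.extend 𝓘(ℝ, ℝ)).right_inv ht]

theorem extend_interval_target_subset {e : OpenPartialHomeomorph J ℝ} (he : e ∈ atlas ℝ J) :
    (e.extend 𝓘(ℝ, ℝ)).target ⊆ J := fun t ht => by
  rw [← coe_extend_interval_symm he ht]
  exact Subtype.coe_prop _

theorem chartVec_interval {e : OpenPartialHomeomorph J ℝ} (he : e ∈ atlas ℝ J) (t : J) (s : ℝ) :
    chartVec 𝓘(ℝ, ℝ) e t s = s := by
  have h1 : (e.extend 𝓘(ℝ, ℝ) : J → ℝ) = extChartAt 𝓘(ℝ, ℝ) t := by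
    ext x
    rw [extend_interval_apply he]
    exact (extend_interval_apply (chart_mem_atlas ℝ t) x).symm
  rw [chartVec, h1, mfderiv_extChartAt_self]
  rfl

theorem chartVecSymm_interval {e : OpenPartialHomeomorph J ℝ} (he : e ∈ atlas ℝ J) {t : ℝ}
    (ht : t ∈ (e.extend 𝓘(ℝ, ℝ)).target) (s : ℝ) : chartVecSymm 𝓘(ℝ, ℝ) e t s = s := by
  rw [← chartVec_interval he ((e.extend 𝓘(ℝ, ℝ)).symm t) (chartVecSymm 𝓘(ℝ, ℝ) e t s)]
  exact chartVec_chartVecSymm he ht s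

variable [IsManifold (𝓡 m) ∞ N]

theorem chartVecSymm_prod {e₁ : OpenPartialHomeomorph J ℝ} (he₁ : e₁ ∈ atlas ℝ J)
    {e₂ : OpenPartialHomeomorph N (EuclideanSpace ℝ (Fin m))}
    (he₂ : e₂ ∈ atlas (EuclideanSpace ℝ (Fin m)) N)
    {y : ℝ × EuclideanSpace ℝ (Fin m)}
    (hy₁ : y.1 ∈ (e₁.extend 𝓘(ℝ, ℝ)).target) (hy₂ : y.2 ∈ (e₂.extend (𝓡 m)).target)
    (u : ℝ × EuclideanSpace ℝ (Fin m)) :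
    chartVecSymm (model m) (e₁.prod e₂) y u =
      ((u.1, chartVecSymm (𝓡 m) e₂ y.2 u.2) : ℝ × EuclideanSpace ℝ (Fin m)) := by
  have h1 := HasMFDerivAt.comp (I := 𝓘(ℝ, ℝ × EuclideanSpace ℝ (Fin m))) y
    (mdifferentiableAt_extend_symm he₁ hy₁).hasMFDerivAt hasFDerivAt_fst.hasMFDerivAt
  have h2 := HasMFDerivAt.comp (I := 𝓘(ℝ, ℝ × EuclideanSpace ℝ (Fin m))) y
    (mdifferentiableAt_extend_symm he₂ hy₂).hasMFDerivAt hasFDerivAt_snd.hasMFDerivAt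
  have h3 := congrArg (fun L : (ℝ × EuclideanSpace ℝ (Fin m)) →L[ℝ]
    (ℝ × EuclideanSpace ℝ (Fin m)) => L u) (h1.prodMk h2).mfderiv
  refine Eq.trans h3 (Prod.ext ?_ rfl)
  exact chartVecSymm_interval he₁ hy₁ u.1

variable (h : ContMDiffRiemannianMetric (𝓡 m) ∞ (EuclideanSpace ℝ (Fin m))
  (fun x : N => TangentSpace (𝓡 m) x)) {a : ℝ → ℝ}

theorem metricIn_warpedMetric {e₁ : OpenPartialHomeomorph J ℝ} (he₁ : e₁ ∈ atlas ℝ J)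
    {e₂ : OpenPartialHomeomorph N (EuclideanSpace ℝ (Fin m))}
    (he₂ : e₂ ∈ atlas (EuclideanSpace ℝ (Fin m)) N)
    {y : ℝ × EuclideanSpace ℝ (Fin m)}
    (hy₁ : y.1 ∈ (e₁.extend 𝓘(ℝ, ℝ)).target) (hy₂ : y.2 ∈ (e₂.extend (𝓡 m)).target) :
    metricIn (model m) (warpedMetric J h a) (e₁.prod e₂) y =
      warpedForm a (metricIn (𝓡 m) h.inner e₂) y := by
  refine ContinuousLinearMap.ext fun u => ContinuousLinearMap.ext fun v => ?_
  rw [metricIn_apply, chartVecSymm_prod he₁ he₂ hy₁ hy₂, chartVecSymm_prod he₁ he₂ hy₁ hy₂,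
    warpedForm_apply, metricIn_apply]
  refine (warpedMetric_apply J h a _ _ _ _ _).trans ?_
  rw [← coe_extend_interval_symm he₁ hy₁]
  rfl

end WarpedCharts

/-! ### Locality of the connection and the Ricci tensor. -/

section Congr

variable {V : Type*} [NormedAddCommGroup V] [NormedSpace ℝ V]
  {G G' : V → V →L[ℝ] V →L[ℝ] ℝ} {s : Set V} {x : V}

theorem IsMetricOn.congr (hG : IsMetricOn G s) (h : Set.EqOn G' G s) : IsMetricOn G' s :=
  ⟨hG.isOpen, hG.contDiffOn.congr h, fun x hx => h hx ▸ hG.symm x hx,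
    fun x hx => h hx ▸ hG.isInvertible x hx⟩

theorem christoffel_congr (h : G' =ᶠ[nhds x] G) : christoffel G' x = christoffel G x := by
  funext u
  rw [christoffel, christoffel, christoffelFirst, christoffelFirst, h.fderiv_eq, h.self_of_nhds]

theorem ricci_congr (h : G' =ᶠ[nhds x] G) : ricci G' x = ricci G x := by
  funext v w
  -- Curvature differentiates $\Gamma$, so agreement is needed on a neighbourhood.
  have h1 : (fun y => christoffel G' y w) =ᶠ[nhds x] fun y => christoffel G y w := by
    filter_upwards [h.eventuallyEq_nhds] with y hy using by rw [christoffel_congr hy]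
  have h2 : curvatureMap G' x v w = curvatureMap G x v w := LinearMap.ext fun u => by
    change curvature G' x u v w = curvature G x u v w
    rw [curvature, curvature, h1.fderiv_eq, christoffel_congr h]
  rw [ricci, ricci, h2]

end Congr

/-! ### The field $\partial_t$ as a torse-forming Ricci eigenfield. -/

section TimeField

variable {m : ℕ} {J : Opens ℝ} {N : Type*} [TopologicalSpace N]
  [ChartedSpace (EuclideanSpace ℝ (Fin m)) N] [IsManifold (𝓡 m) ∞ N]

omit [IsManifold (𝓡 m) ∞ N] in
theorem exists_eq_prod {e : OpenPartialHomeomorph (J × N) (ModelProd ℝ (EuclideanSpace ℝ (Fin m)))}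
    (he : e ∈ atlas (ModelProd ℝ (EuclideanSpace ℝ (Fin m))) (J × N)) :
    ∃ e₁ ∈ atlas ℝ J, ∃ e₂ ∈ atlas (EuclideanSpace ℝ (Fin m)) N, e = e₁.prod e₂ ∧
      (e.extend (model m)).target =
        (e₁.extend 𝓘(ℝ, ℝ)).target ×ˢ (e₂.extend (𝓡 m)).target := by
  obtain ⟨e₁, he₁, e₂, he₂, rfl⟩ := he
  refine ⟨e₁, he₁, e₂, he₂, rfl, ?_⟩
  rw [OpenPartialHomeomorph.extend_prod, PartialEquiv.prod_target]

section Charts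

variable {e : OpenPartialHomeomorph (J × N) (ModelProd ℝ (EuclideanSpace ℝ (Fin m)))}
  (he : e ∈ atlas (ModelProd ℝ (EuclideanSpace ℝ (Fin m))) (J × N))
  {y : ℝ × EuclideanSpace ℝ (Fin m)} (hy : y ∈ (e.extend (model m)).target)

include he hy

omit [IsManifold (𝓡 m) ∞ N] in
theorem coe_extend_symm_fst : (((e.extend (model m)).symm y).1 : ℝ) = y.1 := by
  obtain ⟨e₁, he₁, e₂, he₂, rfl, ht⟩ := exists_eq_prod he
  rw [ht] at hy
  rw [OpenPartialHomeomorph.extend_prod]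
  exact coe_extend_interval_symm he₁ hy.1

theorem chartVec_timeField : chartVec (model m) e ((e.extend (model m)).symm y)
    (timeField J ((e.extend (model m)).symm y)) = ((1, 0) : ℝ × EuclideanSpace ℝ (Fin m)) := by
  have h1 := chartVec_chartVecSymm he hy ((1, 0) : ℝ × EuclideanSpace ℝ (Fin m))
  obtain ⟨e₁, he₁, e₂, he₂, rfl, ht⟩ := exists_eq_prod he
  rw [ht] at hy
  rw [chartVecSymm_prod he₁ he₂ hy.1 hy.2, map_zero] at h1
  exact h1

theorem chartVec_fst (u : TangentSpace (model m) ((e.extend (model m)).symm y)) :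
    (chartVec (model m) e ((e.extend (model m)).symm y) u).1 =
      (u : ℝ × EuclideanSpace ℝ (Fin m)).1 := by
  conv_rhs => rw [← chartVecSymm_chartVec he hy u]
  obtain ⟨e₁, he₁, e₂, he₂, rfl, ht⟩ := exists_eq_prod he
  rw [ht] at hy
  rw [chartVecSymm_prod he₁ he₂ hy.1 hy.2]

end Charts

/-- In the trivialization at $p$ the field has the constant components $(1,0)$. -/
theorem contMDiff_timeField : ContMDiff (model m) (model m).tangent ∞
    (fun p => (⟨p, timeField J p⟩ : TangentBundle (model m) (J × N))) := by
  intro p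
  refine (contMDiffAt_section p).2 ?_
  refine ContMDiffAt.congr_of_eventuallyEq
    (contMDiffAt_const (c := ((1, 0) : ℝ × EuclideanSpace ℝ (Fin m)))) ?_
  have hp := mem_chart_source (ModelProd ℝ (EuclideanSpace ℝ (Fin m))) p
  filter_upwards [(chartAt (ModelProd ℝ (EuclideanSpace ℝ (Fin m))) p).open_source.mem_nhds hp]
    with q hq
  have h1 := TangentBundle.continuousLinearMapAt_trivializationAt (I := model m) hq
  have h2 : chartVec (model m) (chartAt (ModelProd ℝ (EuclideanSpace ℝ (Fin m))) p) q
      (timeField J q) = ((1, 0) : ℝ × EuclideanSpace ℝ (Fin m)) := by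
    obtain ⟨y, hy, rfl⟩ := exists_extend_symm_eq (I := model m) hq
    exact chartVec_timeField (chart_mem_atlas _ p) hy
  rw [← Trivialization.continuousLinearMapAt_apply_of_mem (R := ℝ) _ (by simpa using hq), h1]
  exact h2

variable (h : ContMDiffRiemannianMetric (𝓡 m) ∞ (EuclideanSpace ℝ (Fin m))
  (fun x : N => TangentSpace (𝓡 m) x)) {a : ℝ → ℝ}

theorem warpedMetric_timeField (p : J × N) (u : TangentSpace (model m) p) :
    warpedMetric J h a p u (timeField J p) = -(u : ℝ × EuclideanSpace ℝ (Fin m)).1 := by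
  have h0 (s : ℝ) (v : TangentSpace (𝓡 m) p.2) :
      a p.1 ^ 2 * h.inner p.2 v 0 - s * 1 = -s := by
    rw [map_zero]
    ring
  exact (warpedMetric_apply J h a p _ _ _ _).trans (h0 _ _)

variable (ha : ContDiffOn ℝ ∞ a (J : Set ℝ)) (ha_pos : ∀ t ∈ J, 0 < a t)

include ha ha_pos

omit [IsManifold (𝓡 m) ∞ N] in
theorem contMDiff_hubble : ContMDiff (model m) 𝓘(ℝ, ℝ) ∞ (fun p : J × N => hubble a p.1) := by
  intro p
  have h1 : ContMDiffAt 𝓘(ℝ, ℝ) 𝓘(ℝ, ℝ) ∞ (hubble a) (p.1 : ℝ) :=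
    ((contDiffOn_hubble J.isOpen ha ha_pos).contDiffAt (J.isOpen.mem_nhds p.1.2)).contMDiffAt
  have h2 : ContMDiff (model m) 𝓘(ℝ, ℝ) ∞ (fun p : J × N => (p.1 : ℝ)) :=
    contMDiff_subtype_val.comp contMDiff_fst
  exact h1.comp p h2.contMDiffAt

/-- In every chart of the atlas the metric is a warped product over an open subset of `J`. -/
theorem exists_warpedForm
    {e : OpenPartialHomeomorph (J × N) (ModelProd ℝ (EuclideanSpace ℝ (Fin m)))}
    (he : e ∈ atlas (ModelProd ℝ (EuclideanSpace ℝ (Fin m))) (J × N)) :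
    ∃ (K : EuclideanSpace ℝ (Fin m) → EuclideanSpace ℝ (Fin m) →L[ℝ]
        EuclideanSpace ℝ (Fin m) →L[ℝ] ℝ) (s : Set ℝ) (t : Set (EuclideanSpace ℝ (Fin m))),
      IsOpen s ∧ s ⊆ J ∧ IsOpen t ∧ ContDiffOn ℝ ∞ K t ∧
      (e.extend (model m)).target = s ×ˢ t ∧ IsMetricOn (warpedForm a K) (s ×ˢ t) ∧
      Set.EqOn (metricIn (model m) (warpedMetric J h a) e) (warpedForm a K) (s ×ˢ t) := by
  obtain ⟨e₁, he₁, e₂, he₂, rfl, ht⟩ := exists_eq_prod he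
  have hJ := extend_interval_target_subset he₁
  have hK := contDiffOn_metricIn_riemannian h he₂
  exact ⟨_, _, _, e₁.isOpen_extend_target, hJ, e₂.isOpen_extend_target, hK, ht,
    isMetricOn_warpedForm e₁.isOpen_extend_target e₂.isOpen_extend_target (ha.mono hJ)
      (fun t ht => ha_pos t (hJ ht)) hK (fun y _ u v => h.symm _ _ _)
      (fun y hy u hu => metricIn_riemannian_pos h he₂ hy hu),
    fun y hy => metricIn_warpedMetric h he₁ he₂ hy.1 hy.2⟩

theorem isMetricOn_metricIn_warpedMetric
    {e : OpenPartialHomeomorph (J × N) (ModelProd ℝ (EuclideanSpace ℝ (Fin m)))}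
    (he : e ∈ atlas (ModelProd ℝ (EuclideanSpace ℝ (Fin m))) (J × N)) :
    IsMetricOn (metricIn (model m) (warpedMetric J h a) e) (e.extend (model m)).target := by
  obtain ⟨K, s, t, -, -, -, -, hst, hG, hEq⟩ := exists_warpedForm h ha ha_pos he
  rw [hst]
  exact hG.congr hEq

theorem isTorseForming_timeField :
    IsTorseForming (model m) (warpedMetric J h a) (timeField (N := N) J) := by
  let fst : ℝ × EuclideanSpace ℝ (Fin m) →L[ℝ] ℝ := ContinuousLinearMap.fst ℝ ℝ _
  -- Both are read off from $\nabla_u\partial_t=H(u-dt(u)\,\partial_t)$; as $\eta=-dt$, this is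
  -- again $\omega=\psi\eta$.
  refine ⟨fun p => hubble a p.1, fun p => -hubble a p.1 • fst, contMDiff_hubble ha ha_pos, ?_⟩
  intro e he p hp u
  obtain ⟨y, hy, rfl⟩ := exists_extend_symm_eq (I := model m) hp
  obtain ⟨K, s, t, hs, hsJ, ht, hK, hst, hG, hEq⟩ := exists_warpedForm h ha ha_pos he
  have hy' : y ∈ s ×ˢ t := hst ▸ hy
  have h1 := christoffel_congr (hEq.eventuallyEq_of_mem (hG.isOpen.mem_nhds hy'))
  have h2 : fieldIn (model m) (timeField J) e =ᶠ[nhds y] fun _ => (1, 0) := by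
    filter_upwards [e.isOpen_extend_target.mem_nhds hy] with z hz using chartVec_timeField he hz
  rw [covDerivIn, (e.extend (model m)).right_inv hy, covDeriv, h2.fderiv_eq, h2.self_of_nhds, h1,
    christoffel_warpedForm hG hs ht (ha.mono hsJ) (fun t ht => ha_pos t (hsJ ht)) hK hy',
    map_add, map_smul, map_smul, chartVec_timeField he hy, fderiv_const_apply, zero_apply,
    zero_add, smul_apply, spatialProj_eq]
  have h3 : hubble a ((e.extend (model m)).symm y).1 = hubble a y.1 :=
    congrArg (hubble a) (coe_extend_symm_fst he hy)
  have h4 : -hubble a ((e.extend (model m)).symm y).1 *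
      (u : ℝ × EuclideanSpace ℝ (Fin m)).1 =
      -hubble a y.1 * (chartVec (model m) e ((e.extend (model m)).symm y) u).1 := by
    rw [chartVec_fst he hy u, h3]
  refine Eq.trans ?_ (congrArg₂ (fun r q : ℝ => r • ((1, 0) : ℝ × EuclideanSpace ℝ (Fin m)) +
    q • chartVec (model m) e ((e.extend (model m)).symm y) u) h4 h3).symm
  module

/-- The minus sign of `ricci_warpedForm` is absorbed by $\eta=-dt$. -/
theorem isRicciEigenfield_timeField :
    IsRicciEigenfield (model m) (warpedMetric J h a) (timeField (N := N) J)
      (fun p => m * (deriv (hubble a) p.1 + hubble a p.1 ^ 2)) := by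
  intro e he p hp u
  obtain ⟨y, hy, rfl⟩ := exists_extend_symm_eq (I := model m) hp
  obtain ⟨K, s, t, hs, hsJ, ht, hK, hst, hG, hEq⟩ := exists_warpedForm h ha ha_pos he
  have hy' : y ∈ s ×ˢ t := hst ▸ hy
  rw [ricciIn, (e.extend (model m)).right_inv hy,
    ricci_congr (hEq.eventuallyEq_of_mem (hG.isOpen.mem_nhds hy')), chartVec_timeField he hy,
    ricci_warpedForm hG hs ht (ha.mono hsJ) (fun t ht => ha_pos t (hsJ ht)) hK hy',
    warpedMetric_timeField, chartVec_fst he hy, finrank_euclideanSpace, Fintype.card_fin]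
  beta_reduce
  rw [coe_extend_symm_fst he hy]
  ring

theorem isTorseFormingEigenfield_timeField :
    IsTorseFormingEigenfield (model m) (warpedMetric J h a) (timeField (N := N) J)
      (fun p => m * (deriv (hubble a) p.1 + hubble a p.1 ^ 2)) :=
  ⟨contMDiff_timeField, fun p => warpedMetric_timeField h p _,
    isTorseForming_timeField h ha ha_pos, isRicciEigenfield_timeField h ha ha_pos⟩

end TimeField

end GRW

end

/-! ### The theorem for generalized Robertson–Walker spacetimes. -/

theorem mainTheorem1 {m : ℕ} (hm : 3 ≤ m)
    (J : Opens ℝ) (hJ : IsConnected (J : Set ℝ))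
    {N : Type*} [TopologicalSpace N] [ChartedSpace (EuclideanSpace ℝ (Fin m)) N]
    [IsManifold (𝓡 m) ∞ N]
    (h : ContMDiffRiemannianMetric (𝓡 m) ∞ (EuclideanSpace ℝ (Fin m))
      (fun x : N => TangentSpace (𝓡 m) x))
    (a : ℝ → ℝ) (ha : ContDiffOn ℝ ∞ a (J : Set ℝ)) (ha_pos : ∀ t ∈ J, 0 < a t) :
    (∃ ξ : J × N → ℝ, GRW.IsTorseFormingEigenfield (GRW.model m) (GRW.warpedMetric J h a)
      (GRW.timeField J) ξ) ∧
    ∀ (ρ : ∀ p : J × N, TangentSpace (GRW.model m) p) (ξ : J × N → ℝ),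
      GRW.IsTorseFormingEigenfield (GRW.model m) (GRW.warpedMetric J h a) ρ ξ →
      (∃ p, ξ p ≠ 0) →
      ∀ (f : J × N → ℝ) (lam c : ℝ),
        GRW.IsGradientRicciSoliton (GRW.model m) (GRW.warpedMetric J h a) f lam →
        (∀ p, mfderiv (GRW.model m) 𝓘(ℝ, ℝ) f p (ρ p) = c) →
        GRW.IsPerfectFluid (GRW.model m) (GRW.warpedMetric J h a) ρ := by
  refine ⟨⟨_, GRW.isTorseFormingEigenfield_timeField h ha ha_pos⟩, ?_⟩
  intro ρ ξ hρ hξ f lam c hf hc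
  exact GRW.isPerfectFluid_of_isGradientRicciSoliton
    (fun e he => GRW.isMetricOn_metricIn_warpedMetric h ha ha_pos he) hρ hξ hf hc
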